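/- Let $F$ be a field and let $A$ be an associative, not necessarily unital, $F$-algebra which is a locally matrix algebra, that is, every finite subset of $A$ is contained in a subalgebra $B\subseteq A$ (whose identity element need not be an identity of $A$) with $B\cong M_n(F)$ for some $n\ge 1$. Suppose that $A$ is countable-dimensional, i.e. $\dim_F A=\aleph_0$. Let $\mathrm{Aut}(A)$ be the group of $F$-algebra automorphisms of $A$, let $\mathrm{Inn}(A)$ be its normal subgroup of inner automorphisms, i.e. of conjugations $x\mapsto uxu^{-1}$ by invertible elements $u$ of the algebra $F\oplus A$ obtained from $A$ by adjoining an identity element (if $A$ is unital, these are exactly the conjugations by invertible elements of $A$), and let $\mathrm{Out}(A)=\mathrm{Aut}(A)/\mathrm{Inn}(A)$ be the group of outer automorphisms. Then $$|\mathrm{Aut}(A)|=|\mathrm{Out}(A)|=|F|^{\aleph_0},$$ where $|X|$ denotes the cardinality of a set $X$ and $|F|^{\aleph_0}$ is the cardinality of the set of all maps $\mathbb N\to F$. -/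

import Mathlib

universe u v

namespace LocMat

section

variable (F : Type*) (A : Type*) [Field F] [NonUnitalRing A] [Module F A]
  [IsScalarTower F A A] [SMulCommClass F A A]

/-- A (not necessarily unital) associative `F`-algebra `A` is a locally matrix algebra if every
finite subset of `A` lies in a subalgebra `B` of `A` isomorphic to `M_n(F)` for some `n ≥ 1`.
The unit of `B` need not be a unit of `A`. -/
def IsLocallyMatrix : Prop :=
  ∀ s : Finset A, ∃ (B : NonUnitalSubalgebra F A) (n : ℕ), (s : Set A) ⊆ B ∧ 1 ≤ n ∧
    ∃ f : B →ₙₐ[F] Matrix (Fin n) (Fin n) F, Function.Bijective f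

/-- The group `Aut(A)` of automorphisms of the `F`-algebra `A`: the bijective `F`-linear maps
`A → A` that preserve the product, under composition. -/
def AlgAut : Subgroup (A ≃ₗ[F] A) where
  carrier := {φ | ∀ x y : A, φ (x * y) = φ x * φ y}
  one_mem' := fun _ _ => rfl
  mul_mem' := by
    intro φ ψ hφ hψ x y
    rw [LinearEquiv.mul_apply, LinearEquiv.mul_apply, LinearEquiv.mul_apply, hψ x y, hφ]
  inv_mem' := by
    intro φ hφ x y
    change φ.symm (x * y) = φ.symm x * φ.symm y
    apply φ.injective
    rw [hφ]
    simp

variable {F A}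

/-- An automorphism, extended to the algebra `F ⊕ A` obtained by adjoining a unit. -/
noncomputable def AlgAut.extend (φ : AlgAut F A) : Unitization F A →ₐ[F] Unitization F A :=
  Unitization.lift ((Unitization.inrNonUnitalAlgHom F A).comp
    { toFun := fun x => φ.1 x
      map_smul' := fun c x => map_smul φ.1 c x
      map_zero' := map_zero φ.1
      map_add' := fun x y => map_add φ.1 x y
      map_mul' := φ.2 })

theorem AlgAut.extend_inr (φ : AlgAut F A) (x : A) :
    AlgAut.extend φ (x : Unitization F A) = (φ.1 x : A) := by
  simp [AlgAut.extend]
  rfl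

variable (F A)

/-- The group `Inn(A)` of inner automorphisms, i.e. conjugations `x ↦ u x u⁻¹` by invertible
elements `u` of the algebra `F ⊕ A` obtained by adjoining a unit to `A`.
If `A` has a unit, then `F ⊕ A ≅ F × A` and these are exactly the conjugations by invertible
elements of `A`. -/
noncomputable def Inn : Subgroup (AlgAut F A) where
  carrier := {φ | ∃ u : (Unitization F A)ˣ, ∀ x : A,
    ((φ.1 x : A) : Unitization F A) = u * (x : Unitization F A) * (u⁻¹ : (Unitization F A)ˣ)}
  one_mem' := ⟨1, fun x => by simp⟩
  mul_mem' := by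
    rintro φ ψ ⟨u, hu⟩ ⟨v, hv⟩
    refine ⟨u * v, fun x => ?_⟩
    change ((φ.1 (ψ.1 x) : A) : Unitization F A) = _
    rw [hu, hv]
    simp [mul_assoc]
  inv_mem' := by
    rintro φ ⟨u, hu⟩
    refine ⟨u⁻¹, fun x => ?_⟩
    have h := hu (φ.1.symm x)
    rw [LinearEquiv.apply_symm_apply] at h
    change ((φ.1.symm x : A) : Unitization F A) = _
    rw [h]
    simp [mul_assoc]

instance Inn.instNormal : (Inn F A).Normal where
  conj_mem := by
    rintro φ ⟨u, hu⟩ ψ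
    refine ⟨Units.map (AlgAut.extend ψ : Unitization F A →* Unitization F A) u, fun x => ?_⟩
    change ((ψ.1 (φ.1 (ψ.1.symm x)) : A) : Unitization F A) = _
    rw [← AlgAut.extend_inr, hu, map_mul, map_mul, AlgAut.extend_inr,
      LinearEquiv.apply_symm_apply]
    rfl

/-- The group `Out(A) = Aut(A) / Inn(A)` of outer automorphisms. -/
abbrev Out := AlgAut F A ⧸ Inn F A

end

end LocMat

/-! An automorphism is determined by the images of a countable basis, which gives the upper bound.
For the lower bound, exhaust `A` by matrix subalgebras `B j` so that `B (j + 1)` contains `N j`, `y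
j` centralizing `B j`, with `N j` nonzero of square zero and `N j * y j * N j = N j`. Conjugation by
`1 + a j • N j` fixes `B j` pointwise, so the infinite product of these conjugations stabilizes on
each `B j` and defines an automorphism for every sequence `a`. Its value at `y j` determines `a j`.
An inner automorphism comes from `u = λ + s` with `s` in some `B m`, so it fixes every `y j` with `j
≥ m`. Hence the class in `Out F A` determines `a` up to finitely many terms, and a sequence that
repeats each value infinitely often is recovered entirely. -/

namespace LocMat

/-! ### Square-zero elements in centralizers of matrix algebras -/

section Corner

variable {F V : Type*} [Field F] [AddCommGroup V] [Module F V] [FiniteDimensional F V]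

/-- The corner `p End(V) p` is the endomorphism algebra of the range of `p`. In rank at least 2 it
contains the matrix units `e₀₁` and `e₁₀`, which serve as `N` and `y`. -/
theorem exists_nilpotent_of_two_le_finrank_range (p : Module.End F V) (hp : p * p = p)
    (h : 2 ≤ Module.finrank F (LinearMap.range p)) :
    ∃ N y : Module.End F V, N ≠ 0 ∧ N * N = 0 ∧ N * y * N = N ∧
      p * N = N ∧ N * p = N ∧ p * y = y ∧ y * p = y := by
  let b := Module.finBasis F (LinearMap.range p)
  let i : Fin (Module.finrank F (LinearMap.range p)) := ⟨0, by omega⟩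
  let j : Fin (Module.finrank F (LinearMap.range p)) := ⟨1, by omega⟩
  have hij : i ≠ j := by simp [i, j]
  have hb : ∀ w : LinearMap.range p, p w = w := by
    rintro ⟨_, x, rfl⟩
    exact LinearMap.congr_fun hp x
  have hq : ∀ w : LinearMap.range p, p.rangeRestrict (w : V) = w := fun w => Subtype.ext (hb w)
  have hqp : ∀ x, p.rangeRestrict (p x) = p.rangeRestrict x := fun x =>
    Subtype.ext (LinearMap.congr_fun hp x)
  let T : Fin (Module.finrank F (LinearMap.range p)) →
      Fin (Module.finrank F (LinearMap.range p)) → Module.End F V := fun k l =>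
    (LinearMap.toSpanSingleton F V (b k)).comp ((b.coord l).comp p.rangeRestrict)
  have hT : ∀ k l x, T k l x = b.coord l (p.rangeRestrict x) • (b k : V) := fun k l x => rfl
  have hpT : ∀ k l, p * T k l = T k l := fun k l => by
    ext x
    simp only [Module.End.mul_apply, hT, map_smul, hb]
  have hTp : ∀ k l, T k l * p = T k l := fun k l => by
    ext x
    simp only [Module.End.mul_apply, hT, hqp]
  refine ⟨T i j, T j i, ?_, ?_, ?_, hpT _ _, hTp _ _, hpT _ _, hTp _ _⟩
  · intro h0
    have := LinearMap.congr_fun h0 (b j : V)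
    rw [hT, hq] at this
    simp only [Module.Basis.coord_apply, Module.Basis.repr_self, Finsupp.single_eq_same, one_smul,
      LinearMap.zero_apply, ZeroMemClass.coe_eq_zero] at this
    exact b.ne_zero i this
  · ext x
    simp only [Module.End.mul_apply, hT, map_smul, hq]
    simp [hij]
  · ext x
    simp only [Module.End.mul_apply, hT, map_smul, hq]
    simp

/-- Either `g(e₀₀)` has rank at least 2, and its corner embeds in the centralizer of the image of
`g`; or `g 1` has rank at most `n`, and the corner of `1 - g 1`, annihilated by the image on both
sides, has rank at least 2. -/
theorem exists_nilpotent_commute {n : ℕ} (hn : 1 ≤ n)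
    (g : Matrix (Fin n) (Fin n) F →ₙₐ[F] Module.End F V) (hV : n + 2 ≤ Module.finrank F V) :
    ∃ N y : Module.End F V, N ≠ 0 ∧ N * N = 0 ∧ N * y * N = N ∧
      ∀ x, Commute (g x) N ∧ Commute (g x) y := by
  classical
  let o : Fin n := ⟨0, hn⟩
  let E : Fin n → Fin n → Matrix (Fin n) (Fin n) F := fun i j => Matrix.single i j 1
  have hE : ∀ i j k, E i j * E j k = E i k := fun i j k => by simp [E]
  have hE0 : ∀ i j k l, j ≠ k → E i j * E k l = 0 := fun i j k l h => by
    simp [E, Matrix.single_mul_single_of_ne, h]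
  by_cases h2 : 2 ≤ Module.finrank F (LinearMap.range (g (E o o)))
  · obtain ⟨N, y, hN0, hNN, hNyN, h1, h2, h3, h4⟩ :=
      exists_nilpotent_of_two_le_finrank_range (g (E o o)) (by rw [← map_mul, hE]) h2
    -- Copies an element of the corner of `g (E o o)` along the diagonal, which makes it commute
    -- with all `g (E k l)`.
    let S : Module.End F V → Module.End F V := fun X => ∑ i, g (E i o) * X * g (E o i)
    have hl : ∀ k l X, g (E k l) * S X = g (E k o) * X * g (E o l) := fun k l X => by
      simp only [S, Finset.mul_sum]
      rw [Finset.sum_eq_single l]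
      · rw [← mul_assoc, ← mul_assoc, ← map_mul, hE]
      · intro i _ hi
        rw [← mul_assoc, ← mul_assoc, ← map_mul, hE0 _ _ _ _ hi.symm, map_zero, zero_mul, zero_mul]
      · simp
    have hr : ∀ k l X, S X * g (E k l) = g (E k o) * X * g (E o l) := fun k l X => by
      simp only [S, Finset.sum_mul]
      rw [Finset.sum_eq_single k]
      · rw [mul_assoc, ← map_mul, hE]
      · intro i _ hi
        rw [mul_assoc, ← map_mul, hE0 _ _ _ _ hi, map_zero, mul_zero]
      · simp
    have hS : ∀ X Y, X * g (E o o) = X → S X * S Y = S (X * Y) := fun X Y hX => by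
      change (∑ i, g (E i o) * X * g (E o i)) * S Y = _
      rw [Finset.sum_mul]
      refine Finset.sum_congr rfl fun i _ => ?_
      rw [mul_assoc, hl, mul_assoc, ← mul_assoc X, ← mul_assoc X, hX]
      simp only [mul_assoc]
    have hc : ∀ X x, Commute (g x) (S X) := fun X x => by
      induction x using Matrix.induction_on' with
      | h_zero => rw [map_zero]; exact Commute.zero_left _
      | h_add p q hp hq => rw [map_add]; exact hp.add_left hq
      | h_std_basis k l c =>
        have : Matrix.single k l c = c • E k l := by simp [E]
        rw [this, map_smul]
        exact Commute.smul_left ((hl k l X).trans (hr k l X).symm) c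
    refine ⟨S N, S y, fun h0 => hN0 ?_, ?_, ?_, fun x => ⟨hc _ _, hc _ _⟩⟩
    · have := hl o o N
      rwa [h0, mul_zero, h1, h2, eq_comm] at this
    · rw [hS _ _ h2, hNN]
      simp [S]
    · rw [hS _ _ h2, hS _ _ (by rw [mul_assoc, h4]), hNyN]
  · have hsum : (1 : Matrix (Fin n) (Fin n) F) = ∑ i, E i i := by
      ext a b
      by_cases hab : a = b
      · subst hab
        simp [E, Matrix.sum_apply, Matrix.single_apply]
      · have : ∀ x, ¬(x = a ∧ x = b) := fun x h => hab (h.1.symm.trans h.2)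
        simp [E, Matrix.sum_apply, hab, this]
    have hle : ∀ i, LinearMap.rank (g (E i i)) ≤ 1 := fun i => by
      have h5 : g (E i i) = g (E i o) * g (E o o) * g (E o i) := by simp only [← map_mul, hE]
      have h6 : LinearMap.rank (g (E o o)) ≤ 1 := by
        rw [LinearMap.rank, ← Module.finrank_eq_rank]
        exact_mod_cast (by omega : Module.finrank F (LinearMap.range (g (E o o))) ≤ 1)
      rw [h5]
      exact ((LinearMap.rank_comp_le_left _ _).trans (LinearMap.rank_comp_le_right _ _)).trans h6
    have h7 : LinearMap.rank (g 1) ≤ n := by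
      rw [hsum, map_sum]
      refine (LinearMap.rank_finsetSum_le _ _).trans ((Finset.sum_le_sum fun i _ => hle i).trans ?_)
      simp
    have h8 : Module.rank F V ≤ LinearMap.rank (g 1) + LinearMap.rank (1 - g 1) := by
      have := LinearMap.rank_add_le (g 1) (1 - g 1)
      rw [add_sub_cancel] at this
      refine le_trans ?_ this
      rw [show (1 : Module.End F V) = LinearMap.id from rfl, LinearMap.rank, LinearMap.range_id,
        rank_top]
    have h9 : 2 ≤ Module.finrank F (LinearMap.range (1 - g 1)) := by
      simp only [LinearMap.rank, ← Module.finrank_eq_rank] at h7 h8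
      norm_cast at h7 h8
      omega
    have h11 : g 1 * g 1 = g 1 := by rw [← map_mul, one_mul]
    obtain ⟨N, y, hN0, hNN, hNyN, h1, h2, h3, h4⟩ :=
      exists_nilpotent_of_two_le_finrank_range (1 - g 1)
        (by rw [mul_sub, mul_one, sub_mul, one_mul, h11, sub_self, sub_zero]) h9
    have hc : ∀ X, (1 - g 1) * X = X → X * (1 - g 1) = X → ∀ x, Commute (g x) X := by
      intro X hl hr x
      have e1 : g x * X = 0 := by
        rw [← hl, ← mul_assoc, mul_sub, mul_one, ← map_mul, mul_one, sub_self, zero_mul]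
      have e2 : X * g x = 0 := by
        rw [← hr, mul_assoc, sub_mul, one_mul, ← map_mul, one_mul, sub_self, mul_zero]
      exact e1.trans e2.symm
    exact ⟨N, y, hN0, hNN, hNyN, fun x => ⟨hc N h1 h2 x, hc y h3 h4 x⟩⟩

end Corner

/-! ### Countable bases -/

section Basis

variable {F : Type u} {A : Type v} [Field F] [AddCommGroup A] [Module F A]

theorem exists_basis_nat (hdim : Module.rank F A = Cardinal.aleph0) :
    Nonempty (Module.Basis ℕ F A) := by
  let c := Module.Basis.ofVectorSpace F A
  obtain ⟨d⟩ := Cardinal.denumerable_iff.2 (c.mk_eq_rank''.trans hdim)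
  exact ⟨c.reindex (Denumerable.eqv _)⟩

end Basis

/-! ### The chain of matrix subalgebras -/

section Chain

variable {F : Type u} {A : Type v} [Field F] [NonUnitalRing A] [Module F A]

/-- A subalgebra isomorphic to `M_n(F)` for some `n ≥ 1`. -/
def IsMatrixSubalgebra (B : NonUnitalSubalgebra F A) : Prop :=
  ∃ n : ℕ, 1 ≤ n ∧ ∃ f : B →ₙₐ[F] Matrix (Fin n) (Fin n) F, Function.Bijective f

theorem IsMatrixSubalgebra.exists_extension (hA : IsLocallyMatrix F A)
    (hdim : Cardinal.aleph0 ≤ Module.rank F A) {B : NonUnitalSubalgebra F A}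
    (hB : IsMatrixSubalgebra B) (s : A) :
    ∃ B' : NonUnitalSubalgebra F A, IsMatrixSubalgebra B' ∧ B ≤ B' ∧ s ∈ B' ∧
      ∃ N ∈ B', ∃ y ∈ B', N ≠ 0 ∧ N * N = 0 ∧ N * y * N = N ∧
        ∀ x ∈ B, Commute x N ∧ Commute x y := by
  classical
  obtain ⟨n, hn, f, hf⟩ := hB
  have hfin : B.toSubmodule.FG := by
    rw [Submodule.fg_iff_finiteDimensional]
    exact Module.Finite.of_injective (f : B →ₗ[F] Matrix (Fin n) (Fin n) F) hf.1
  obtain ⟨S, hS⟩ := hfin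
  -- Including `(n + 2) ^ 2` independent elements in `B'` forces `m ^ 2 ≥ (n + 2) ^ 2`, hence the
  -- room `n + 2 ≤ m` needed for the centralizer.
  obtain ⟨I, hIc, hI⟩ := exists_finset_linearIndependent_of_le_rank (R := F) (M := A)
    (n := (n + 2) ^ 2) (le_trans (Cardinal.natCast_lt_aleph0).le hdim)
  obtain ⟨B', m, hB', hm, f', hf'⟩ := hA (insert s (S ∪ I))
  have hBB' : B ≤ B' := by
    have : B.toSubmodule ≤ B'.toSubmodule := by
      rw [← hS, Submodule.span_le]
      intro x hx
      exact hB' (by simp only [Finset.mem_coe] at hx; simp [hx])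
    exact this
  have hnm : n + 2 ≤ m := by
    have hfin' : Module.Finite F B' :=
      Module.Finite.of_injective (f' : B' →ₗ[F] Matrix (Fin m) (Fin m) F) hf'.1
    have h1 : (n + 2) ^ 2 ≤ Module.finrank F B' := by
      have hli : LinearIndependent F
          (fun x : I => (⟨x, hB' (by simp)⟩ : B')) :=
        LinearIndependent.of_comp B'.toSubmodule.subtype hI
      have := hli.fintype_card_le_finrank
      rwa [Fintype.card_coe, hIc] at this
    have h2 : Module.finrank F B' ≤ Module.finrank F (Matrix (Fin m) (Fin m) F) :=
      LinearMap.finrank_le_finrank_of_injective (f := (f' : B' →ₗ[F] Matrix (Fin m) (Fin m) F))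
        hf'.1
    rw [Module.finrank_matrix] at h2
    simp only [Fintype.card_fin, Module.finrank_self, mul_one] at h2
    nlinarith
  let e := Equiv.ofBijective f hf
  let e' := Equiv.ofBijective f' hf'
  let fi := f.inverse e.symm e.left_inv e.right_inv
  let T := Matrix.toLinAlgEquiv' (R := F) (n := Fin m)
  let g : Matrix (Fin n) (Fin n) F →ₙₐ[F] Module.End F (Fin m → F) :=
    (T : Matrix (Fin m) (Fin m) F →ₙₐ[F] Module.End F (Fin m → F)).comp
      (f'.comp ((NonUnitalSubalgebra.inclusion hBB').comp fi))
  obtain ⟨N, y, hN0, hNN, hNyN, hc⟩ := exists_nilpotent_commute hn g (by simpa using hnm)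
  let h : B' → Module.End F (Fin m → F) := fun x => T (f' x)
  have hinj : Function.Injective h := T.injective.comp hf'.1
  have hmul : ∀ x y, h (x * y) = h x * h y := fun x y => by simp only [h, map_mul]
  have hzero : h 0 = 0 := by simp only [h, map_zero]
  have hsurj : Function.Surjective h := T.surjective.comp hf'.2
  obtain ⟨N, rfl⟩ := hsurj N
  obtain ⟨y, rfl⟩ := hsurj y
  have hg : ∀ x (hx : x ∈ B), g (f ⟨x, hx⟩) = h ⟨x, hBB' hx⟩ := fun x hx => by
    change h (NonUnitalSubalgebra.inclusion hBB' (e.symm (e ⟨x, hx⟩))) = _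
    rw [e.symm_apply_apply]
    rfl
  have key : ∀ z : B', (∀ x, Commute (g x) (h z)) → ∀ x ∈ B, Commute x z := by
    intro z hz x hx
    have h1 := hz (f ⟨x, hx⟩)
    rw [hg, Commute, SemiconjBy, ← hmul, ← hmul] at h1
    exact congrArg Subtype.val (hinj h1)
  refine ⟨B', ⟨m, hm, f', hf'⟩, hBB', hB' (by simp), N, N.2, y, y.2, ?_, ?_, ?_, fun x hx =>
    ⟨key N (fun x => (hc x).1) x hx, key y (fun x => (hc x).2) x hx⟩⟩
  · intro h0
    apply hN0
    rw [show N = 0 from Subtype.ext h0, hzero]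
  · rw [← hmul, ← hzero] at hNN
    exact congrArg Subtype.val (hinj hNN)
  · rw [← hmul, ← hmul] at hNyN
    exact congrArg Subtype.val (hinj hNyN)

/-- An exhaustive chain of matrix subalgebras, with a square-zero element and a generalized inverse
of it at each step, both centralizing the previous subalgebra. -/
structure IsNilpotentChain (B : ℕ → NonUnitalSubalgebra F A) (N y : ℕ → A) : Prop where
  mono : Monotone B
  exhaustive : ∀ x, ∃ j, x ∈ B j
  mem_nil : ∀ j, N j ∈ B (j + 1)
  mem_inv : ∀ j, y j ∈ B (j + 1)
  nil_ne_zero : ∀ j, N j ≠ 0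
  nil_mul_nil : ∀ j, N j * N j = 0
  nil_mul_inv_mul_nil : ∀ j, N j * y j * N j = N j
  commute_nil : ∀ j, ∀ x ∈ B j, Commute x (N j)
  commute_inv : ∀ j, ∀ x ∈ B j, Commute x (y j)

theorem exists_isNilpotentChain (hA : IsLocallyMatrix F A)
    (hdim : Module.rank F A = Cardinal.aleph0) :
    ∃ (B : ℕ → NonUnitalSubalgebra F A) (N y : ℕ → A), IsNilpotentChain B N y := by
  obtain ⟨b⟩ := exists_basis_nat hdim
  let St := {B : NonUnitalSubalgebra F A // IsMatrixSubalgebra B}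
  have step := fun (C : St) (s : A) => C.2.exists_extension hA hdim.ge s
  choose nx hnx hle hmem N hN y hy h0 hNN hNyN hc using step
  obtain ⟨B₀, n, -, hn, f, hf⟩ := hA ∅
  -- Step `k` absorbs the basis vector `b k`, so the union of the chain is all of `A`.
  let C : ℕ → St := fun j => Nat.rec ⟨B₀, n, hn, f, hf⟩ (fun k C => ⟨nx C (b k), hnx C (b k)⟩) j
  have hmono : Monotone fun j => (C j).1 := monotone_nat_of_le_succ fun j => hle (C j) (b j)
  refine ⟨fun j => (C j).1, fun j => N (C j) (b j), fun j => y (C j) (b j), hmono, fun x => ?_,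
    fun j => hN _ _, fun j => hy _ _, fun j => h0 _ _, fun j => hNN _ _, fun j => hNyN _ _,
    fun j x hx => (hc _ _ x hx).1, fun j x hx => (hc _ _ x hx).2⟩
  induction b.mem_span x using Submodule.span_induction with
  | mem x hx =>
    obtain ⟨i, rfl⟩ := hx
    exact ⟨i + 1, hmem _ _⟩
  | zero => exact ⟨0, zero_mem _⟩
  | add p q _ _ hp hq =>
    obtain ⟨i, hi⟩ := hp
    obtain ⟨j, hj⟩ := hq
    exact ⟨max i j, add_mem (hmono (le_max_left i j) hi) (hmono (le_max_right i j) hj)⟩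
  | smul c x _ hx =>
    obtain ⟨i, hi⟩ := hx
    exact ⟨i, SMulMemClass.smul_mem c hi⟩

end Chain

/-! ### Infinite products of automorphisms -/

section InfiniteProduct

variable {F : Type u} {A : Type v} [Field F] [NonUnitalRing A] [Module F A]

/-- The conditions under which the infinite product of the automorphisms `c j` converges along the
chain `B`. -/
structure IsCompatible (B : ℕ → NonUnitalSubalgebra F A) (c : ℕ → AlgAut F A) : Prop where
  mono : Monotone B
  exhaustive : ∀ x, ∃ j, x ∈ B j
  apply_eq : ∀ j, ∀ x ∈ B j, (c j).1 x = x
  symm_mem : ∀ i j, j < i → ∀ x ∈ B i, (c j).1.symm x ∈ B i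

/-- The product `c 0 * c 1 * ⋯ * c (j - 1)`. -/
def partialProd (c : ℕ → AlgAut F A) : ℕ → AlgAut F A
  | 0 => 1
  | j + 1 => partialProd c j * c j

theorem partialProd_succ_apply (c : ℕ → AlgAut F A) (j : ℕ) (x : A) :
    (partialProd c (j + 1)).1 x = (partialProd c j).1 ((c j).1 x) := rfl

theorem partialProd_apply_of_forall (c : ℕ → AlgAut F A) (j : ℕ) {x : A}
    (h : ∀ i < j, (c i).1 x = x) : (partialProd c j).1 x = x := by
  induction j with
  | zero => rfl
  | succ j ih =>
    rw [partialProd_succ_apply, h j j.lt_succ_self, ih fun i hi => h i (hi.trans j.lt_succ_self)]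

variable {B : ℕ → NonUnitalSubalgebra F A} {c : ℕ → AlgAut F A}

namespace IsCompatible

theorem partialProd_eq (h : IsCompatible B c) {j k : ℕ} (hjk : j ≤ k) {x : A} (hx : x ∈ B j) :
    (partialProd c k).1 x = (partialProd c j).1 x := by
  induction k, hjk using Nat.le_induction with
  | base => rfl
  | succ k hk ih => rw [partialProd_succ_apply, h.apply_eq k x (h.mono hk hx), ih]

/-- Needed for surjectivity of the limit: a preimage of `x` under the partial product stays where
the limit agrees with that product. -/
theorem partialProd_symm_mem (h : IsCompatible B c) {i j : ℕ} (hij : j ≤ i) {x : A} (hx : x ∈ B i) :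
    (partialProd c j).1.symm x ∈ B i := by
  induction j generalizing x with
  | zero => exact hx
  | succ j ih => exact h.symm_mem i j hij _ (ih (Nat.le_of_succ_le hij) hx)

theorem exists_limit (h : IsCompatible B c) :
    ∃ φ : AlgAut F A, ∀ j, ∀ x ∈ B j, φ.1 x = (partialProd c j).1 x := by
  classical
  let f : A → A := fun x => (partialProd c (Nat.find (h.exhaustive x))).1 x
  have hf : ∀ j, ∀ x ∈ B j, f x = (partialProd c j).1 x := fun j x hx =>
    (h.partialProd_eq (Nat.find_min' (h.exhaustive x) hx) (Nat.find_spec (h.exhaustive x))).symm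
  have common : ∀ x y, ∃ j, x ∈ B j ∧ y ∈ B j := fun x y => by
    obtain ⟨i, hi⟩ := h.exhaustive x
    obtain ⟨j, hj⟩ := h.exhaustive y
    exact ⟨max i j, h.mono (le_max_left i j) hi, h.mono (le_max_right i j) hj⟩
  let L : A →ₗ[F] A :=
    { toFun := f
      map_add' := fun x y => by
        obtain ⟨j, hx, hy⟩ := common x y
        rw [hf j _ (add_mem hx hy), hf j x hx, hf j y hy, map_add]
      map_smul' := fun r x => by
        obtain ⟨j, hx⟩ := h.exhaustive x
        rw [hf j _ (SMulMemClass.smul_mem r hx), hf j x hx, map_smul, RingHom.id_apply] }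
  have hL : Function.Bijective L := by
    constructor
    · intro x y hxy
      obtain ⟨j, hx, hy⟩ := common x y
      change f x = f y at hxy
      rw [hf j x hx, hf j y hy] at hxy
      exact (partialProd c j).1.injective hxy
    · intro x
      obtain ⟨j, hx⟩ := h.exhaustive x
      refine ⟨(partialProd c j).1.symm x, ?_⟩
      exact (hf j _ (h.partialProd_symm_mem le_rfl hx)).trans (LinearEquiv.apply_symm_apply _ _)
  refine ⟨⟨LinearEquiv.ofBijective L hL, fun x y => ?_⟩, hf⟩
  obtain ⟨j, hx, hy⟩ := common x y
  change f (x * y) = f x * f y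
  rw [hf j _ (mul_mem hx hy), hf j x hx, hf j y hy, (partialProd c j).2]

end IsCompatible

theorem exists_algAut_embedding (b : Module.Basis ℕ F A) :
    Nonempty (AlgAut F A ↪ (ℕ → F)) := by
  let f : AlgAut F A → ℕ × ℕ → F := fun φ p => b.repr (φ.1 (b p.1)) p.2
  have hf : Function.Injective f := fun φ ψ h => by
    refine Subtype.ext (LinearEquiv.toLinearMap_injective (b.ext fun i => b.repr.injective ?_))
    ext j
    exact congrFun h (i, j)
  exact ⟨(⟨f, hf⟩ : AlgAut F A ↪ (ℕ × ℕ → F)).trans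
    (Nat.pairEquiv.arrowCongr (Equiv.refl F)).toEmbedding⟩

end InfiniteProduct

/-! ### Unipotent conjugations and their classes modulo inner automorphisms -/

section Unipotent

variable {F : Type u} {A : Type v} [Field F] [NonUnitalRing A] [Module F A]
  [IsScalarTower F A A] [SMulCommClass F A A]

/-- Since `M * M = 0`, the inverse of `1 + M` is `1 - M`, and `(1 + M) x (1 - M)` expands to an
expression that makes sense without a unit. -/
theorem conj_sub_mul_conj_sub {M x y : A} (hM : M * M = 0) :
    (x + (M * x - x * M) - M * x * M) * (y + (M * y - y * M) - M * y * M) =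
      x * y + (M * (x * y) - x * y * M) - M * (x * y) * M := by
  have h : ∀ z, M * (M * z) = 0 := fun z => by rw [← mul_assoc, hM, zero_mul]
  simp only [mul_add, mul_sub, add_mul, sub_mul, mul_assoc, h, mul_zero]
  abel

theorem conj_conj_neg {M x : A} (hM : M * M = 0) :
    x + (M * x - x * M) - M * x * M + (-M * (x + (M * x - x * M) - M * x * M) -
      (x + (M * x - x * M) - M * x * M) * -M) - -M * (x + (M * x - x * M) - M * x * M) * -M = x := by
  have h : ∀ z, M * (M * z) = 0 := fun z => by rw [← mul_assoc, hM, zero_mul]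
  simp only [mul_add, mul_sub, add_mul, sub_mul, mul_assoc, neg_mul, mul_neg, h, hM, mul_zero]
  abel

variable (F) in
/-- Conjugation by `1 + M`, where `M` has square zero. -/
def unipotentConj (M : A) (hM : M * M = 0) : AlgAut F A :=
  ⟨{ toFun := fun x => x + (M * x - x * M) - M * x * M
     invFun := fun x => x + (-M * x - x * -M) - -M * x * -M
     map_add' := fun x y => by simp only [mul_add, add_mul]; abel
     map_smul' := fun c x => by
      simp only [mul_smul_comm, smul_mul_assoc, smul_add, smul_sub, RingHom.id_apply]
     left_inv := fun x => conj_conj_neg hM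
     right_inv := fun x => by
      have := conj_conj_neg (M := -M) (x := x) (by rw [neg_mul_neg, hM])
      simpa only [neg_neg] using this },
    fun _ _ => (conj_sub_mul_conj_sub hM).symm⟩

theorem unipotentConj_apply {M : A} (hM : M * M = 0) (x : A) :
    (unipotentConj F M hM).1 x = x + (M * x - x * M) - M * x * M := rfl

variable {B : ℕ → NonUnitalSubalgebra F A}

namespace IsNilpotentChain

variable {N y : ℕ → A}

theorem smul_mul_smul_eq_zero (h : IsNilpotentChain B N y) (r : F) (j : ℕ) :
    (r • N j) * (r • N j) = 0 := by
  rw [smul_mul_smul_comm, h.nil_mul_nil, smul_zero]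

theorem isCompatible (h : IsNilpotentChain B N y) (a : ℕ → F) :
    IsCompatible B fun j => unipotentConj F (a j • N j) (h.smul_mul_smul_eq_zero (a j) j) where
  mono := h.mono
  exhaustive := h.exhaustive
  apply_eq j x hx := by
    have hc : x * (a j • N j) = (a j • N j) * x := (h.commute_nil j x hx).smul_right (a j)
    rw [unipotentConj_apply, mul_assoc _ x, hc, ← mul_assoc, h.smul_mul_smul_eq_zero, zero_mul,
      sub_self, add_zero, sub_zero]
  symm_mem i j hij x hx := by
    have hM : -(a j • N j) ∈ B i := neg_mem (SMulMemClass.smul_mem _ (h.mono hij (h.mem_nil j)))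
    exact sub_mem (add_mem hx (sub_mem (mul_mem hM hx) (mul_mem hx hM)))
      (mul_mem (mul_mem hM hx) hM)

/-- The limit of the conjugations by `(1 + a 0 • N 0) * ⋯ * (1 + a j • N j)`. -/
noncomputable def aut (h : IsNilpotentChain B N y) (a : ℕ → F) : AlgAut F A :=
  (h.isCompatible a).exists_limit.choose

/-- Factors after the `j`-th fix `y j`, which lies in `B (j + 1)`. Earlier ones act trivially
because `N i ∈ B j` for `i < j` commutes with both `N j` and `y j`. -/
theorem aut_apply_inv (h : IsNilpotentChain B N y) (a : ℕ → F) (j : ℕ) :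
    (h.aut a).1 (y j) = (unipotentConj F (a j • N j) (h.smul_mul_smul_eq_zero (a j) j)).1 (y j) := by
  rw [aut, (h.isCompatible a).exists_limit.choose_spec (j + 1) (y j) (h.mem_inv j),
    partialProd_succ_apply]
  refine partialProd_apply_of_forall _ _ fun i hi => ?_
  have hN : N i ∈ B j := h.mono hi (h.mem_nil i)
  have hM : Commute (a i • N i) (unipotentConj F (a j • N j)
      (h.smul_mul_smul_eq_zero (a j) j) |>.1 (y j)) := by
    have h1 : Commute (a i • N i) (y j) := (h.commute_inv j _ hN).smul_left _
    have h2 : Commute (a i • N i) (a j • N j) :=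
      ((h.commute_nil j _ hN).smul_right _).smul_left _
    rw [unipotentConj_apply]
    exact (h1.add_right ((h2.mul_right h1).sub_right (h1.mul_right h2))).sub_right
      ((h2.mul_right h1).mul_right h2)
  rw [unipotentConj_apply (h.smul_mul_smul_eq_zero (a i) i), hM.eq, mul_assoc,
    h.smul_mul_smul_eq_zero, mul_zero, sub_self, add_zero, sub_zero]

/-- Left multiplication by `N j` turns the image of `y j` into `N j * y j - a j • N j`, and `N j ≠
0`. -/
theorem eq_of_aut_apply_inv_eq (h : IsNilpotentChain B N y) {a b : ℕ → F} {j : ℕ}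
    (hab : (h.aut a).1 (y j) = (h.aut b).1 (y j)) : a j = b j := by
  have key : ∀ r : F, N j * (unipotentConj F (r • N j) (h.smul_mul_smul_eq_zero r j)).1 (y j) =
      N j * y j - r • N j := fun r => by
    rw [unipotentConj_apply]
    simp only [smul_mul_assoc, mul_smul_comm, mul_add, mul_sub, ← mul_assoc, h.nil_mul_nil,
      zero_mul, smul_zero, h.nil_mul_inv_mul_nil, sub_zero, zero_sub, ← sub_eq_add_neg]
  rw [h.aut_apply_inv, h.aut_apply_inv] at hab
  have h1 := congrArg (N j * ·) hab
  simp only [key] at h1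
  exact smul_left_injective F (h.nil_ne_zero j) (sub_right_injective h1)

theorem exists_forall_inner_apply_eq (h : IsNilpotentChain B N y) {φ : AlgAut F A}
    (hφ : φ ∈ Inn F A) : ∃ m, ∀ j, m ≤ j → φ.1 (y j) = y j := by
  obtain ⟨u, hu⟩ := hφ
  obtain ⟨m, hm⟩ := h.exhaustive (u : Unitization F A).snd
  refine ⟨m, fun j hj => ?_⟩
  have hc : Commute (u : Unitization F A) (y j : Unitization F A) := by
    rw [← Unitization.inl_fst_add_inr_snd_eq (u : Unitization F A)]
    refine Commute.add_left ?_ ?_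
    · exact Unitization.inl_mul_inr .. |>.trans (Unitization.inr_mul_inl ..).symm
    · have := h.commute_inv j _ (h.mono hj hm)
      rw [Commute, SemiconjBy, ← Unitization.inr_mul, ← Unitization.inr_mul, this.eq]
  have := hu (y j)
  rw [hc.eq, mul_assoc, Units.mul_inv, mul_one] at this
  exact Unitization.inr_injective this

theorem out_mk_aut_injective (h : IsNilpotentChain B N y) :
    Function.Injective fun a : ℕ → F =>
      (QuotientGroup.mk (h.aut fun j => a j.unpair.1) : Out F A) := by
  intro a b hab
  obtain ⟨m, hm⟩ := h.exists_forall_inner_apply_eq (QuotientGroup.eq.1 hab)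
  funext i
  -- The index `Nat.pair i m` is at least `m`, and the sequence there takes the value `a i`.
  have h1 := congrArg (h.aut fun j => a j.unpair.1).1 (hm (Nat.pair i m) (Nat.right_le_pair i m))
  have h2 : (h.aut fun j => b j.unpair.1).1 (y (Nat.pair i m)) =
      (h.aut fun j => a j.unpair.1).1 (y (Nat.pair i m)) :=
    (LinearEquiv.apply_symm_apply _ _).symm.trans h1
  simpa using (h.eq_of_aut_apply_inv_eq h2).symm

end IsNilpotentChain

end Unipotent

end LocMat

theorem theorem8 {F : Type u} {A : Type v} [Field F] [NonUnitalRing A] [Module F A]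
    [IsScalarTower F A A] [SMulCommClass F A A]
    (hA : LocMat.IsLocallyMatrix F A) (hdim : Module.rank F A = Cardinal.aleph0) :
    Cardinal.lift.{u} (Cardinal.mk (LocMat.AlgAut F A)) =
        Cardinal.lift.{v} (Cardinal.mk F ^ Cardinal.aleph0) ∧
      Cardinal.lift.{u} (Cardinal.mk (LocMat.Out F A)) =
        Cardinal.lift.{v} (Cardinal.mk F ^ Cardinal.aleph0) := by
  have hF : Cardinal.mk F ^ Cardinal.aleph0 = Cardinal.mk (ℕ → F) := by simp
  rw [hF]
  obtain ⟨B, N, y, h⟩ := LocMat.exists_isNilpotentChain hA hdim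
  obtain ⟨b⟩ := LocMat.exists_basis_nat hdim
  have hupper := Cardinal.lift_mk_le'.2 (LocMat.exists_algAut_embedding b)
  have hlower := Cardinal.lift_mk_le'.2 ⟨⟨_, h.out_mk_aut_injective⟩⟩
  have hquot : Cardinal.lift.{u} (Cardinal.mk (LocMat.Out F A)) ≤
      Cardinal.lift.{u} (Cardinal.mk (LocMat.AlgAut F A)) :=
    Cardinal.lift_le.2
      (Cardinal.mk_le_of_surjective (QuotientGroup.mk_surjective (s := LocMat.Inn F A)))
  exact ⟨hupper.antisymm (hlower.trans hquot), (hquot.trans hupper).antisymm hlower⟩
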